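/- **Complexes.** Let $N_1,N_2,N_3,N_5,N_6$ be the $2$-dimensional simplicial complexes with vertex set $\{0,1,\dots,11\}$ whose $2$-simplices are the following $28$ triples (a triple $\{u,v,w\}$ is written $uvw$, with $a=10$ and $b=11$) and whose simplices are all nonempty subsets of these triples. - $N_1$: $012$, $01b$, $026$, $048$, $04a$, $068$, $0ab$, $123$, $137$, $159$, $15b$, $179$, $234$, $248$, $26a$, $28a$, $345$, $359$, $37b$, $39b$, $456$, $46a$, $567$, $57b$, $678$, $789$, $89a$, $9ab$. - $N_2$: $015$, $016$, $048$, $04b$, $05b$, $067$, $078$, $126$, $127$, $159$, $178$, $189$, $237$, $238$, $26a$, $289$, $29a$, $348$, $349$, $37b$, $39a$, $3ab$, $459$, $45a$, $4ab$, $56a$, $56b$, $67b$. - $N_3$: $028$, $02b$, $046$, $048$, $06a$, $09a$, $09b$, $124$, $12b$, $134$, $137$, $159$, $15b$, $179$, $24a$, $268$, $26a$, $346$, $356$, $359$, $37b$, $39b$, $48a$, $568$, $578$, $57b$, $78a$, $79a$. - $N_5$: $012$, $019$, $02b$, $048$, $04b$, $078$, $079$, $12a$, $145$, $14b$, $159$,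 $1ab$, $235$, $23b$, $256$, $26a$, $346$, $348$, $358$, $367$, $37b$, $456$, $589$, $679$, $69a$, $78a$, $7ab$, $89a$. - $N_6$: $017$, $01a$, $03a$, $03b$, $048$, $04b$, $078$, $127$, $128$, $158$, $159$, $19a$, $267$, $26a$, $28b$, $29a$, $29b$, $345$, $346$, $35a$, $367$, $37b$, $458$, $469$, $49b$, $569$, $56a$, $78b$. **Permutations.** Put $\sigma=(0,1,2,\dots,11)$, $\tau=(1,4)(2,3)(8,9)(6,11)(0,5)(7,10)$, $\alpha=(0,4,8)(1,5,9)(2,6,10)(3,7,11)$, $\beta=(0,2)(4,10)(1,11)(3,9)(5,7)(6,8)$, $\alpha_1=(1,2)(3,4)(5,6)(7,8)(9,10)(11,0)$, $\alpha_2=(1,3)(2,4)(5,7)(6,8)(9,11)(10,0)$. **Definitions.** For a finite simplicial complex $K$ with vertex set $V$, let $\mathrm{Aut}(K)$ be the group of permutations $\pi$ of $V$ such that, for $s\subseteq V$, $\pi(s)$ is a simplex if and only if $s$ is. Let $|K|\subseteq[0,1]^V$ be the subspace of functions $f$ with $\sum_v f(v)=1$ whose support is a simplex of $K$; each $\pi\in\mathrm{Aut}(K)$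 induces the homeomorphism $|\pi|(f)=f\circ\pi^{-1}$ of $|K|$. If $|K|$ is a connected orientable closed surface, let $\mathrm{Hom}^+(|K|)$ be the group of its orientation-preserving homeomorphisms (the homeomorphisms that have local degree $+1$ at every point with respect to an orientation of $|K|$; the choice of the orientation does not matter). A homomorphism $\iota\colon G\to\mathrm{Aut}(K)$ from a finite group $G$ is said to define an *effective orientation-preserving simplicial action* of $G$ on $|K|$ if $|K|$ is a connected orientable closed surface, $\iota$ is injective, and $g\mapsto|\iota(g)|$ is an injective homomorphism from $G$ into $\mathrm{Hom}^+(|K|)$. Let $D_n$ be the dihedral group of order $2n$, generated by a rotation $r$ of order $n$ and a reflection $s$. **Lemma.** There are homomorphisms $\iota$ that define effective orientation-preserving simplicial actions 1. of $\mathbb Z_6$ on $|N_1|$, with $\iota(\bar 1)=\sigma^2$; 2. of $\mathbb Z_6$ on $|N_2|$, with $\iota(\bar 1)=\sigma^2$; 3. of $D_6$ on $|N_3|$, with $\iota(r)=\sigma^2$ and $\iota(s)=\tau$; 4. of $D_3$ on $|N_5|$, with $\iota(r)=\alpha$ and $\iota(s)=\beta$; 5. of $\mathbb Z_2\times\mathbb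 Z_2$ on $|N_6|$, with $\iota(1,0)=\alpha_1$ and $\iota(0,1)=\alpha_2$. -/

import Mathlib

namespace DoubleTorus

/-! ## Finite simplicial complexes, automorphisms, geometric carrier -/

section Complexes

variable {V : Type*}

/-- The simplicial complex whose faces are the triples `{u, v, w}` for `(u, v, w)` in the list `F`,
and whose simplices are the nonempty subsets of these triples. -/
def ofFaces [DecidableEq V] (F : List (V × V × V))
    (h : ∀ x : V, ∃ t ∈ F, x ∈ ({t.1, t.2.1, t.2.2} : Finset V)) :
    AbstractSimplicialComplex V where
  faces := {s | s.Nonempty ∧ ∃ t ∈ F, s ⊆ {t.1, t.2.1, t.2.2}}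
  isRelLowerSet_faces := by
    rintro s ⟨hs, t, ht, hst⟩
    exact ⟨hs, fun u hus hu => ⟨hu, t, ht, subset_trans hus hst⟩⟩
  singleton_mem v := by
    obtain ⟨t, ht, hv⟩ := h v
    exact ⟨Finset.singleton_nonempty v, t, ht, Finset.singleton_subset_iff.2 hv⟩

/-- The automorphism group of a simplicial complex: the permutations `π` of the vertex set such
that `π(s)` is a simplex iff `s` is a simplex. -/
def autGroup (K : AbstractSimplicialComplex V) : Subgroup (Equiv.Perm V) where
  carrier := {π | ∀ s : Finset V, s.map π.toEmbedding ∈ K.faces ↔ s ∈ K.faces}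
  one_mem' s := by
    have h : s.map (1 : Equiv.Perm V).toEmbedding = s := Finset.map_refl
    rw [h]
  mul_mem' {π ρ} hπ hρ s := by
    have h : s.map (π * ρ).toEmbedding = (s.map ρ.toEmbedding).map π.toEmbedding := by
      rw [Finset.map_map]; rfl
    rw [h, hπ, hρ]
  inv_mem' {π} hπ s := by
    have h : (s.map (π⁻¹).toEmbedding).map π.toEmbedding = s := by
      rw [Finset.map_map]
      refine Eq.trans (congrArg (fun e => s.map e) ?_) Finset.map_refl
      ext x
      exact π.apply_symm_apply x
    rw [← hπ, h]

variable [Fintype V]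

/-- The geometric carrier `|K|`: the functions `f : V → [0,1]` with `∑ f(v) = 1` whose support is
a simplex of `K`. As a subtype of `V → ℝ` it has the subspace topology of the product topology. -/
def Carrier (K : AbstractSimplicialComplex V) : Type _ :=
  {f : V → ℝ // (∀ v, f v ∈ Set.Icc (0 : ℝ) 1) ∧ ∑ v, f v = 1 ∧
    ∃ s ∈ K.faces, (s : Set V) = Function.support f}

instance instTopologicalSpaceCarrier (K : AbstractSimplicialComplex V) :
    TopologicalSpace (Carrier K) :=
  instTopologicalSpaceSubtype

/-- The map of `|K|` to itself induced by an automorphism `π`, namely `f ↦ f ∘ π⁻¹`; it is affine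
on every geometric simplex and sends the vertex `v` to the vertex `π v`. -/
def carrierMap (K : AbstractSimplicialComplex V) (π : autGroup K) (f : Carrier K) : Carrier K :=
  ⟨fun v => f.1 ((π : Equiv.Perm V).symm v), by
    obtain ⟨h01, hsum, s, hs, hsf⟩ := f.2
    refine ⟨fun v => h01 _, ?_, s.map (π : Equiv.Perm V).toEmbedding, (π.2 s).2 hs, ?_⟩
    · exact (Equiv.sum_comp (π : Equiv.Perm V).symm f.1).trans hsum
    · ext v
      have hv := Set.ext_iff.1 hsf ((π : Equiv.Perm V).symm v)
      simp only [Finset.mem_coe, Function.mem_support] at hv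
      simp [hv]⟩

theorem continuous_carrierMap (K : AbstractSimplicialComplex V) (π : autGroup K) :
    Continuous (carrierMap K π) := by
  refine Continuous.subtype_mk (continuous_pi fun v => ?_) _
  exact (continuous_apply _).comp continuous_subtype_val

theorem carrierMap_mul (K : AbstractSimplicialComplex V) (π ρ : autGroup K) (f : Carrier K) :
    carrierMap K (π * ρ) f = carrierMap K π (carrierMap K ρ f) := by
  apply Subtype.ext; rfl

theorem carrierMap_one (K : AbstractSimplicialComplex V) (f : Carrier K) :
    carrierMap K 1 f = f := by
  apply Subtype.ext; rfl

/-- `π ↦ |π|`, as a homomorphism from the automorphism group of `K` to the group of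
homeomorphisms of `|K|`. -/
def realize (K : AbstractSimplicialComplex V) : autGroup K →* (Carrier K ≃ₜ Carrier K) where
  toFun π :=
    { toFun := carrierMap K π
      invFun := carrierMap K π⁻¹
      left_inv := fun f => by rw [← carrierMap_mul, inv_mul_cancel, carrierMap_one]
      right_inv := fun f => by rw [← carrierMap_mul, mul_inv_cancel, carrierMap_one]
      continuous_toFun := continuous_carrierMap K π
      continuous_invFun := continuous_carrierMap K π⁻¹ }
  map_one' := Homeomorph.ext fun f => carrierMap_one K f
  map_mul' π ρ := Homeomorph.ext fun f => carrierMap_mul K π ρ f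

end Complexes

/-! ## Orientations of surfaces and orientation-preserving homeomorphisms -/

section Surfaces

open Set Filter Topology Real

/-- The path `γ : [0, 2π] → ℂ` avoids `w` and the total change of a continuous argument of
`γ - w` along it is `2πn`. For a closed path: `γ` has winding number `n` about `w`. -/
def HasWindingNumber (γ : ℝ → ℂ) (w : ℂ) (n : ℤ) : Prop :=
  (∀ t ∈ Icc 0 (2 * π), γ t ≠ w) ∧
    ∃ θ : ℝ → ℝ, ContinuousOn θ (Icc 0 (2 * π)) ∧
      (∀ t ∈ Icc 0 (2 * π),
        γ t - w = (‖γ t - w‖ : ℂ) * Complex.exp ((θ t : ℂ) * Complex.I)) ∧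
      θ (2 * π) - θ 0 = 2 * π * n

/-- `h`, a homeomorphism between open sets of the plane near `z`, preserves the orientation at
`z` (has local degree `1` there): it maps every sufficiently small positively oriented circle
about `z` to a closed curve with winding number `1` about `h z`. -/
def PreservesOrientationAt (h : ℂ → ℂ) (z : ℂ) : Prop :=
  ∀ᶠ r : ℝ in 𝓝[>] 0,
    HasWindingNumber (fun t : ℝ => h (z + r * Complex.exp ((t : ℂ) * Complex.I))) (h z) 1

/-- A connected closed surface: a compact connected Hausdorff space that is locally homeomorphic
to the plane. -/
structure IsClosedSurface (X : Type*) [TopologicalSpace X] : Prop where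
  compact : CompactSpace X
  hausdorff : T2Space X
  connected : ConnectedSpace X
  locallyPlanar : ∀ x : X, ∃ e : OpenPartialHomeomorph X ℂ, x ∈ e.source

/-- An orientation of a topological surface: an atlas of charts into the plane all of whose
coordinate changes preserve the orientation of the plane at every point. -/
structure SurfaceOrientation (X : Type*) [TopologicalSpace X] where
  charts : Set (OpenPartialHomeomorph X ℂ)
  cover : ∀ x : X, ∃ e ∈ charts, x ∈ e.source
  compatible : ∀ e ∈ charts, ∀ e' ∈ charts, ∀ x ∈ e.source ∩ e'.source,
    PreservesOrientationAt (fun z => e' (e.symm z)) (e x)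

/-- `Hom⁺(X)` for a surface `X` oriented by `O`: the homeomorphisms of `X` that, read in charts of
`O`, preserve the orientation of the plane at every point. (On a connected orientable surface
there are exactly two orientations and both give the same set.) -/
def orientationPreservingHomeos {X : Type*} [TopologicalSpace X] (O : SurfaceOrientation X) :
    Set (X ≃ₜ X) :=
  {f | ∀ e ∈ O.charts, ∀ e' ∈ O.charts, ∀ x ∈ e.source, f x ∈ e'.source →
    PreservesOrientationAt (fun z => e' (f (e.symm z))) (e x)}

end Surfaces

/-- The homomorphism `ι : G → Aut(K)` makes `G` act simplicially, effectively and
orientation-preservingly on `|K|`: `|K|` is an orientable connected closed surface, `ι` is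
injective, and `g ↦ |ι(g)|` is an injective homomorphism from `G` into `Hom⁺(|K|)`. -/
structure ActsSimplicially {G V : Type*} [Group G] [Fintype V]
    (K : AbstractSimplicialComplex V) (ι : G →* autGroup K) : Prop where
  surface : IsClosedSurface (Carrier K)
  injective : Function.Injective ι
  effective : Function.Injective ((realize K).comp ι)
  preserves : ∃ O : SurfaceOrientation (Carrier K),
    ∀ g : G, (realize K).comp ι g ∈ orientationPreservingHomeos O

/-! ## The five triangulations of the double-torus, on the vertex set `{0, …, 11}` -/

/-- The complex `N1`, given by its 28 faces. -/
def N1 : AbstractSimplicialComplex (Fin 12) :=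
  ofFaces
    [(0, 1, 2), (0, 1, 11), (0, 2, 6), (0, 4, 8), (0, 4, 10), (0, 6, 8), (0, 10, 11),
     (1, 2, 3), (1, 3, 7), (1, 5, 9), (1, 5, 11), (1, 7, 9), (2, 3, 4), (2, 4, 8),
     (2, 6, 10), (2, 8, 10), (3, 4, 5), (3, 5, 9), (3, 7, 11), (3, 9, 11), (4, 5, 6),
     (4, 6, 10), (5, 6, 7), (5, 7, 11), (6, 7, 8), (7, 8, 9), (8, 9, 10), (9, 10, 11)]
    (by decide)

/-- The complex `N2`, given by its 28 faces. -/
def N2 : AbstractSimplicialComplex (Fin 12) :=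
  ofFaces
    [(0, 1, 5), (0, 1, 6), (0, 4, 8), (0, 4, 11), (0, 5, 11), (0, 6, 7), (0, 7, 8),
     (1, 2, 6), (1, 2, 7), (1, 5, 9), (1, 7, 8), (1, 8, 9), (2, 3, 7), (2, 3, 8),
     (2, 6, 10), (2, 8, 9), (2, 9, 10), (3, 4, 8), (3, 4, 9), (3, 7, 11), (3, 9, 10),
     (3, 10, 11), (4, 5, 9), (4, 5, 10), (4, 10, 11), (5, 6, 10), (5, 6, 11), (6, 7, 11)]
    (by decide)

/-- The complex `N3`, given by its 28 faces. -/
def N3 : AbstractSimplicialComplex (Fin 12) :=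
  ofFaces
    [(0, 2, 8), (0, 2, 11), (0, 4, 6), (0, 4, 8), (0, 6, 10), (0, 9, 10), (0, 9, 11),
     (1, 2, 4), (1, 2, 11), (1, 3, 4), (1, 3, 7), (1, 5, 9), (1, 5, 11), (1, 7, 9),
     (2, 4, 10), (2, 6, 8), (2, 6, 10), (3, 4, 6), (3, 5, 6), (3, 5, 9), (3, 7, 11),
     (3, 9, 11), (4, 8, 10), (5, 6, 8), (5, 7, 8), (5, 7, 11), (7, 8, 10), (7, 9, 10)]
    (by decide)

/-- The complex `N5`, given by its 28 faces. -/
def N5 : AbstractSimplicialComplex (Fin 12) :=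
  ofFaces
    [(0, 1, 2), (0, 1, 9), (0, 2, 11), (0, 4, 8), (0, 4, 11), (0, 7, 8), (0, 7, 9),
     (1, 2, 10), (1, 4, 5), (1, 4, 11), (1, 5, 9), (1, 10, 11), (2, 3, 5), (2, 3, 11),
     (2, 5, 6), (2, 6, 10), (3, 4, 6), (3, 4, 8), (3, 5, 8), (3, 6, 7), (3, 7, 11),
     (4, 5, 6), (5, 8, 9), (6, 7, 9), (6, 9, 10), (7, 8, 10), (7, 10, 11), (8, 9, 10)]
    (by decide)

/-- The complex `N6`, given by its 28 faces. -/
def N6 : AbstractSimplicialComplex (Fin 12) :=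
  ofFaces
    [(0, 1, 7), (0, 1, 10), (0, 3, 10), (0, 3, 11), (0, 4, 8), (0, 4, 11), (0, 7, 8),
     (1, 2, 7), (1, 2, 8), (1, 5, 8), (1, 5, 9), (1, 9, 10), (2, 6, 7), (2, 6, 10),
     (2, 8, 11), (2, 9, 10), (2, 9, 11), (3, 4, 5), (3, 4, 6), (3, 5, 10), (3, 6, 7),
     (3, 7, 11), (4, 5, 8), (4, 6, 9), (4, 9, 11), (5, 6, 9), (5, 6, 10), (7, 8, 11)]
    (by decide)

/-! ## The permutations of `{0, …, 11}` used -/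

/-- `(0, 1, …, 11)`, that is `v ↦ v + 1` modulo 12. -/
def sigma : Equiv.Perm (Fin 12) := Equiv.addRight 1

/-- `(0, 4, 8)(1, 5, 9)(2, 6, 10)(3, 7, 11)`, that is `v ↦ v + 4` modulo 12. -/
def alpha : Equiv.Perm (Fin 12) := Equiv.addRight 4

/-- `(1, 4)(2, 3)(8, 9)(6, 11)(0, 5)(7, 10)`, given by the list of the images of `0, 1, …, 11`. -/
def tau : Equiv.Perm (Fin 12) :=
  Function.Involutive.toPerm ![5, 4, 3, 2, 1, 0, 11, 10, 9, 8, 7, 6]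
    (by unfold Function.Involutive; decide)

/-- `(0, 2)(4, 10)(1, 11)(3, 9)(5, 7)(6, 8)`, given by the list of the images of `0, 1, …, 11`. -/
def beta : Equiv.Perm (Fin 12) :=
  Function.Involutive.toPerm ![2, 11, 0, 9, 10, 7, 8, 5, 6, 3, 4, 1]
    (by unfold Function.Involutive; decide)

/-- `(1, 2)(3, 4)(5, 6)(7, 8)(9, 10)(11, 0)`, given by the list of the images of `0, 1, …, 11`. -/
def alpha1 : Equiv.Perm (Fin 12) :=
  Function.Involutive.toPerm ![11, 2, 1, 4, 3, 6, 5, 8, 7, 10, 9, 0]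
    (by unfold Function.Involutive; decide)

/-- `(1, 3)(2, 4)(5, 7)(6, 8)(9, 11)(10, 0)`, given by the list of the images of `0, 1, …, 11`. -/
def alpha2 : Equiv.Perm (Fin 12) :=
  Function.Involutive.toPerm ![10, 3, 4, 1, 2, 7, 8, 5, 6, 11, 0, 9]
    (by unfold Function.Involutive; decide)

end DoubleTorus

/-!
Write `χ k = exp (2πik/n)` for `k : ZMod n`. In each of the five complexes every vertex `v` has as
link a cycle of length `n = 7`, and the cyclic orders of all the links can be chosen coherently, so
that they come from one orientation of the triangles; this is a `RotationSystem`.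

*Charts.* On the open star `{f | 0 < f v}` the chart at `v` is `f ↦ ∑ k, f (link v k) χ k`, which
sends `v` to `0` and the link to the vertices of a regular `n`-gon. For `n ≥ 4` its inverse is
explicit: the coordinate of a point of the polygon at the corner `χ j` is a piecewise linear
function `hat j` of the point (`hat_cone`), so the open star is homeomorphic to the open set
`∑ j, hat j < 1`. Thus `|K|` is locally planar; it is Hausdorff, it is closed in a cube, and it is
connected because the open stars are (they are star-shaped) and the 1-skeleton is connected.

*Orientation.* Every local degree is computed by one criterion,
`preservesOrientationAt_of_slitPlane`: `h` has local degree `1` at `z` as soon as, for some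
constant `c ≠ 0`, the quotients `(h z' - h z) / (c (z' - z))` avoid the closed negative real axis;
for then the principal argument of the quotient corrects the obvious argument of the circle to a
continuous argument of its image. For the charts `e`, `e'` at the two ends of an edge, take `c` to
be the complex number that maps the direction of the edge in `e` to its direction in `e'`. For two
points of the star of the edge, the numerator and the denominator then have, after division by a
common factor, the same imaginary part, and they are equal when it vanishes
(`RotationSystem.exists_slitPlane`). So no case distinction between points inside triangles and
points on edges is needed.

*Automorphisms.* A permutation that carries links to links, preserving the cyclic orders, only
multiplies the charts by roots of unity (`starMap_carrierMap`), so it preserves the orientation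
too. What is left, that the given faces form a rotation system and that the given permutations
preserve it and satisfy the relations of the groups, is a finite check.
-/

/-! ### Winding numbers, and piecewise linear coordinates on a regular polygon -/

namespace DoubleTorus
open Set Filter Topology Real

/-- The argument used for the image of the circle is `t + arg c + arg (Q t)`, where `Q t` is the
quotient in `hslit` at the point with parameter `t`; it is continuous since `arg` is continuous on
the slit plane. -/
theorem hasWindingNumber_circle {h : ℂ → ℂ} {z c : ℂ} {r : ℝ} {U : Set ℂ} (hr : 0 < r)
    (hU : Metric.closedBall z r ⊆ U) (hc : c ≠ 0) (hcont : ContinuousOn h U)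
    (hslit : ∀ z' ∈ U, z' ≠ z → (h z' - h z) / (c * (z' - z)) ∈ Complex.slitPlane) :
    HasWindingNumber (fun t : ℝ => h (z + r * Complex.exp ((t : ℂ) * Complex.I))) (h z) 1 := by
  have hmem (t : ℝ) : z + r * Complex.exp ((t : ℂ) * Complex.I) ∈ U := by
    apply hU
    simp [Complex.norm_exp_ofReal_mul_I, abs_of_pos hr]
  have hne (t : ℝ) : (r : ℂ) * Complex.exp ((t : ℂ) * Complex.I) ≠ 0 :=
    mul_ne_zero (by exact_mod_cast hr.ne') (Complex.exp_ne_zero _)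
  set γ : ℝ → ℂ := fun t => h (z + r * Complex.exp ((t : ℂ) * Complex.I)) with hγ
  set Q : ℝ → ℂ := fun t => (γ t - h z) / (c * (r * Complex.exp ((t : ℂ) * Complex.I))) with hQ
  have hQs (t : ℝ) : Q t ∈ Complex.slitPlane := by
    have := hslit _ (hmem t) (by simpa using hne t)
    simpa [hQ, hγ] using this
  have hγc : Continuous γ := by
    refine hcont.comp_continuous (by fun_prop) hmem
  have hQc : Continuous Q :=
    (hγc.sub continuous_const).div (by fun_prop) fun t => mul_ne_zero hc (hne t)
  have hγQ (t : ℝ) : γ t - h z = c * (r * Complex.exp ((t : ℂ) * Complex.I)) * Q t := by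
    rw [mul_comm]
    exact (div_eq_iff (mul_ne_zero hc (hne t))).1 rfl
  refine ⟨fun t _ h0 => ?_, fun t => t + c.arg + (Q t).arg, ?_, fun t _ => ?_, ?_⟩
  · have := hγQ t
    rw [sub_eq_zero.2 h0] at this
    exact mul_ne_zero (mul_ne_zero hc (hne t)) (Complex.slitPlane_ne_zero (hQs t)) this.symm
  · refine Continuous.continuousOn ((by fun_prop : Continuous fun t : ℝ => t + c.arg).add ?_)
    exact continuous_iff_continuousAt.2 fun t =>
      (Complex.continuousAt_arg (hQs t)).comp hQc.continuousAt
  · rw [hγQ t]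
    conv_lhs => rw [← Complex.norm_mul_exp_arg_mul_I c, ← Complex.norm_mul_exp_arg_mul_I (Q t)]
    simp only [norm_mul, Complex.norm_exp_ofReal_mul_I, Complex.norm_real, Real.norm_eq_abs,
      abs_of_pos hr, Complex.ofReal_mul, Complex.ofReal_add, add_mul, Complex.exp_add,
      Complex.ofReal_one]
    ring
  · have : Q (2 * π) = Q 0 := by
      simp [hQ, hγ, Complex.exp_two_pi_mul_I]
    simp [this]

/-- A map has local degree `1` at `z` if its difference quotients based at `z` avoid the ray
opposite to some fixed `c ≠ 0`. No differentiability is needed. -/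
theorem preservesOrientationAt_of_slitPlane {h : ℂ → ℂ} {z c : ℂ} {U : Set ℂ} (hU : IsOpen U)
    (hz : z ∈ U) (hc : c ≠ 0) (hcont : ContinuousOn h U)
    (hslit : ∀ z' ∈ U, z' ≠ z → (h z' - h z) / (c * (z' - z)) ∈ Complex.slitPlane) :
    PreservesOrientationAt h z := by
  obtain ⟨ε, hε, hball⟩ := Metric.isOpen_iff.1 hU z hz
  filter_upwards [Ioo_mem_nhdsGT hε] with r hr
  exact hasWindingNumber_circle hr.1 ((Metric.closedBall_subset_ball hr.2).trans hball) hc hcont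
    hslit

/-- The criterion `preservesOrientationAt_of_slitPlane` read in a chart `e`. -/
theorem preservesOrientationAt_comp_symm {X : Type*} [TopologicalSpace X]
    (e : OpenPartialHomeomorph X ℂ) {φ : X → ℂ} {W : Set X} {x : X} {c : ℂ} (hW : IsOpen W)
    (hx : x ∈ e.source) (hxW : x ∈ W) (hφ : ContinuousOn φ W) (hc : c ≠ 0)
    (hslit : ∀ f ∈ e.source ∩ W, ∀ g ∈ e.source ∩ W, f ≠ g →
      (φ f - φ g) / (c * (e f - e g)) ∈ Complex.slitPlane) :
    PreservesOrientationAt (fun z => φ (e.symm z)) (e x) := by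
  refine preservesOrientationAt_of_slitPlane (U := e.target ∩ e.symm ⁻¹' W)
    (e.isOpen_inter_preimage_symm hW) ⟨e.map_source hx, by simpa [e.left_inv hx] using hxW⟩ hc
    (hφ.comp (e.continuousOn_symm.mono inter_subset_left) fun z hz => hz.2) ?_
  rintro z ⟨hz, hzW⟩ hne
  have := hslit (e.symm z) ⟨e.map_target hz, hzW⟩ x ⟨hx, hxW⟩ (by
    rintro rfl; exact hne (e.right_inv hz).symm)
  rwa [e.right_inv hz, ← e.left_inv hx, e.right_inv (e.map_source hx)] at this

theorem sin_two_pi_div_pos {n : ℕ} (hn : 3 ≤ n) : 0 < sin (2 * π / n) := by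
  have h3 : (3 : ℝ) ≤ n := by exact_mod_cast hn
  refine sin_pos_of_pos_of_lt_pi (by positivity) ?_
  rw [div_lt_iff₀ (by linarith)]
  nlinarith [pi_pos]

section Fan

variable {n : ℕ} [NeZero n]

open ZMod

theorem stdAddChar_natCast (m : ℕ) :
    stdAddChar (m : ZMod n) = Complex.exp ((m * (2 * π / n) : ℝ) * Complex.I) := by
  have := stdAddChar_coe (N := n) (m : ℤ)
  rw [Int.cast_natCast] at this
  rw [this]; congr 1; push_cast; ring

theorem stdAddChar_intCast (m : ℤ) :
    stdAddChar (m : ZMod n) = Complex.exp ((m * (2 * π / n) : ℝ) * Complex.I) := by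
  rw [stdAddChar_coe]; congr 1; push_cast; ring

theorem stdAddChar_one_im : (stdAddChar (1 : ZMod n)).im = sin (2 * π / n) := by
  have := stdAddChar_natCast (n := n) 1
  rw [Nat.cast_one] at this
  rw [this, Complex.exp_ofReal_mul_I_im]; simp

theorem stdAddChar_one_re : (stdAddChar (1 : ZMod n)).re = cos (2 * π / n) := by
  have := stdAddChar_natCast (n := n) 1
  rw [Nat.cast_one] at this
  rw [this, Complex.exp_ofReal_mul_I_re]; simp

theorem stdAddChar_ne_zero (k : ZMod n) : (stdAddChar k : ℂ) ≠ 0 := by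
  have := (stdAddChar (N := n)).norm_apply k
  intro h; simp [h] at this

/-- The cones spanned by consecutive corners of the regular `n`-gon cover the plane. -/
theorem exists_mem_cone (hn : 3 ≤ n) (z : ℂ) : ∃ (k : ZMod n) (a b : ℝ), 0 ≤ a ∧ 0 ≤ b ∧
    z = a * stdAddChar k + b * stdAddChar (k + 1) := by
  have hs := sin_two_pi_div_pos hn
  have h3 : (3 : ℝ) ≤ n := by exact_mod_cast hn
  set α : ℝ := 2 * π / n with hα
  have hαpos : 0 < α := by positivity
  have hαπ : α < π := by
    rw [hα, div_lt_iff₀ (by linarith)]; nlinarith [pi_pos]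
  set q : ℤ := ⌊z.arg / α⌋
  set φ : ℝ := z.arg - q * α with hφ
  have h0 : 0 ≤ φ := by
    have := Int.floor_le (z.arg / α)
    rw [le_div_iff₀ hαpos] at this
    linarith
  have h1 : φ < α := by
    have := Int.lt_floor_add_one (z.arg / α)
    rw [div_lt_iff₀ hαpos] at this
    linarith
  refine ⟨(q : ZMod n), ‖z‖ * sin (α - φ) / sin α, ‖z‖ * sin φ / sin α, ?_, ?_, ?_⟩
  · exact div_nonneg (mul_nonneg (norm_nonneg _)
      (sin_nonneg_of_nonneg_of_le_pi (by linarith) (by linarith))) hs.le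
  · exact div_nonneg (mul_nonneg (norm_nonneg _)
      (sin_nonneg_of_nonneg_of_le_pi h0 (by linarith))) hs.le
  -- the law of sines in the cone with angles `φ` and `α - φ` at the origin
  · have key : (sin (α - φ) : ℂ) + sin φ * stdAddChar (1 : ZMod n)
        = sin α * Complex.exp ((φ : ℂ) * Complex.I) := by
      apply Complex.ext
      · rw [Complex.add_re, Complex.re_ofReal_mul, Complex.re_ofReal_mul,
          Complex.exp_ofReal_mul_I_re, stdAddChar_one_re, Complex.ofReal_re, sin_sub]
        ring
      · rw [Complex.add_im, Complex.im_ofReal_mul, Complex.im_ofReal_mul,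
          Complex.exp_ofReal_mul_I_im, stdAddChar_one_im, Complex.ofReal_im]
        ring
    have hsC : (sin α : ℂ) ≠ 0 := by exact_mod_cast hs.ne'
    have harg : (z.arg : ℂ) * Complex.I = ((q * α : ℝ) : ℂ) * Complex.I + (φ : ℂ) * Complex.I := by
      rw [hφ]; push_cast; ring
    rw [AddChar.map_add_eq_mul]
    calc z = ‖z‖ * (stdAddChar (q : ZMod n) * Complex.exp ((φ : ℂ) * Complex.I)) := by
          conv_lhs => rw [← Complex.norm_mul_exp_arg_mul_I z, harg, Complex.exp_add]
          rw [stdAddChar_intCast]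
      _ = ‖z‖ * stdAddChar (q : ZMod n) / sin α *
          (sin α * Complex.exp ((φ : ℂ) * Complex.I)) := by field_simp
      _ = _ := by rw [← key]; push_cast; ring

/-- The coordinate at the corner `χ j` of the regular `n`-gon: the function that is linear on each
cone spanned by consecutive corners, takes the value `1` at `χ j` and vanishes at the other
corners. It is written as the minimum of the two linear functions that agree with it on the two
cones at `χ j`, cut off at `0`; this is correct for `n ≥ 4` (`hat_cone`). -/
noncomputable def hat (j : ZMod n) (z : ℂ) : ℝ :=
  max 0 (min (z * stdAddChar (1 - j)).im (-(z * stdAddChar (-(j + 1))).im)) / sin (2 * π / n)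

theorem continuous_hat (j : ZMod n) : Continuous (hat j) := by
  unfold hat
  refine Continuous.div_const ?_ _
  refine continuous_const.max (Continuous.min ?_ ?_)
  · exact Complex.continuous_im.comp (by fun_prop)
  · exact (Complex.continuous_im.comp (by fun_prop)).neg

theorem hat_nonneg (hn : 3 ≤ n) (j : ZMod n) (z : ℂ) : 0 ≤ hat j z :=
  div_nonneg (le_max_left _ _) (sin_two_pi_div_pos hn).le

theorem hat_cone (hn : 4 ≤ n) (j k : ZMod n) {a b : ℝ} (ha : 0 ≤ a) (hb : 0 ≤ b) :
    hat j (a * stdAddChar k + b * stdAddChar (k + 1)) =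
      if j = k then a else if j = k + 1 then b else 0 := by
  have hs := sin_two_pi_div_pos (n := n) (by omega)
  have h4 : (4 : ℝ) ≤ n := by exact_mod_cast hn
  have hn0 : (0 : ℝ) < n := by linarith
  unfold hat
  set α : ℝ := 2 * π / n with hα
  have hnα : n * α = 2 * π := by rw [hα]; field_simp
  have hαpos : 0 < α := by positivity
  have h2α : 2 * α ≤ π := by nlinarith
  have hs2 : 0 ≤ sin (2 * α) := sin_nonneg_of_nonneg_of_le_pi (by linarith) h2α
  -- the index `j` relative to `k`
  obtain ⟨m, hm, rfl⟩ : ∃ m : ℕ, m < n ∧ j = k + m :=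
    ⟨(j - k).val, ZMod.val_lt _, by simp⟩
  have him (i : ℤ) : (stdAddChar (i : ZMod n)).im = sin (i * α) := by
    rw [stdAddChar_intCast, Complex.exp_ofReal_mul_I_im]
  have e1 : ((a * stdAddChar k + b * stdAddChar (k + 1)) *
      stdAddChar (1 - (k + (m : ZMod n))) : ℂ).im
      = a * sin ((1 - m) * α) + b * sin ((2 - m) * α) := by
    have h1 := him (1 - m)
    have h2 := him (2 - m)
    have : ((a * stdAddChar k + b * stdAddChar (k + 1)) * stdAddChar (1 - (k + (m : ZMod n))) : ℂ)
      = a * stdAddChar ((1 - m : ℤ) : ZMod n) + b * stdAddChar ((2 - m : ℤ) : ZMod n) := by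
      rw [add_mul, mul_assoc, mul_assoc, ← AddChar.map_add_eq_mul, ← AddChar.map_add_eq_mul]
      congr 4 <;> (push_cast; ring)
    rw [this, Complex.add_im, Complex.im_ofReal_mul, Complex.im_ofReal_mul, h1, h2]
    push_cast; ring
  have e2 : -((a * stdAddChar k + b * stdAddChar (k + 1)) *
      stdAddChar (-(k + (m : ZMod n) + 1)) : ℂ).im
      = a * sin ((m + 1) * α) + b * sin (m * α) := by
    have h1 := him (-(m + 1))
    have h2 := him (-m)
    have : ((a * stdAddChar k + b * stdAddChar (k + 1)) *
        stdAddChar (-(k + (m : ZMod n) + 1)) : ℂ)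
      = a * stdAddChar ((-(m + 1) : ℤ) : ZMod n) + b * stdAddChar ((-m : ℤ) : ZMod n) := by
      rw [add_mul, mul_assoc, mul_assoc, ← AddChar.map_add_eq_mul, ← AddChar.map_add_eq_mul]
      congr 4 <;> (push_cast; ring)
    rw [this, Complex.add_im, Complex.im_ofReal_mul, Complex.im_ofReal_mul, h1, h2]
    push_cast
    rw [neg_mul, neg_mul, sin_neg, sin_neg]; ring
  rw [e1, e2]
  have h10 : (1 : ZMod n) ≠ 0 := by
    have : Fact (1 < n) := ⟨by omega⟩
    exact one_ne_zero
  rcases Nat.lt_or_ge m 2 with hm2 | hm2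
  · interval_cases m
    · simp only [Nat.cast_zero, add_zero, if_true, sub_zero, one_mul, zero_add, zero_mul, sin_zero,
        mul_zero]
      rw [min_eq_right (by nlinarith), max_eq_right (by positivity)]
      field_simp
    · simp only [Nat.cast_one, sub_self, zero_mul, sin_zero, mul_zero, zero_add, one_mul]
      rw [if_neg (by simpa using h10), if_pos trivial, show (1 + 1 : ℝ) = 2 by norm_num,
        show (2 - 1 : ℝ) = 1 by norm_num, one_mul, min_eq_left (by nlinarith),
        max_eq_right (by positivity)]
      field_simp
  · rw [if_neg, if_neg, max_eq_left, zero_div]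
    · have hm2' : (2 : ℝ) ≤ m := by exact_mod_cast hm2
      have hmn : (m : ℝ) + 1 ≤ n := by exact_mod_cast hm
      -- one of the two linear functions is nonpositive on the whole cone
      rcases le_total ((m - 1) * α) π with h | h
      · refine (min_le_left _ _).trans ?_
        have s1 : 0 ≤ sin ((m - 1) * α) :=
          sin_nonneg_of_nonneg_of_le_pi (by nlinarith) h
        have s2 : 0 ≤ sin ((m - 2) * α) :=
          sin_nonneg_of_nonneg_of_le_pi (by nlinarith) (by nlinarith)
        rw [show (1 - m : ℝ) * α = -((m - 1) * α) by ring,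
          show (2 - m : ℝ) * α = -((m - 2) * α) by ring, sin_neg, sin_neg]
        nlinarith [mul_nonneg ha s1, mul_nonneg hb s2]
      · refine (min_le_right _ _).trans ?_
        have hneg (x : ℝ) (h0 : π ≤ x) (h1 : x ≤ 2 * π) : sin x ≤ 0 := by
          rw [← sin_sub_two_pi]
          exact sin_nonpos_of_nonpos_of_neg_pi_le (by linarith) (by linarith)
        have s1 := hneg ((m + 1) * α) (by nlinarith) (by nlinarith)
        have s2 := hneg (m * α) (by nlinarith) (by nlinarith)
        nlinarith [mul_nonneg ha (neg_nonneg.2 s1), mul_nonneg hb (neg_nonneg.2 s2)]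
    · intro h
      have h' : ((m : ℕ) : ZMod n) = ((1 : ℕ) : ZMod n) := by simpa using h
      rw [ZMod.natCast_eq_natCast_iff', Nat.mod_eq_of_lt hm, Nat.mod_eq_of_lt (by omega)] at h'
      omega
    · intro h
      have h' : ((m : ℕ) : ZMod n) = ((0 : ℕ) : ZMod n) := by simpa using h
      rw [ZMod.natCast_eq_natCast_iff', Nat.mod_eq_of_lt hm, Nat.mod_eq_of_lt (by omega)] at h'
      omega

end Fan
end DoubleTorus

/-! ### Rotation systems and the charts on open stars -/

namespace DoubleTorus
open Set Filter Topology Real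

/-- A coherent orientation of a complex all of whose vertices have degree `n`: the link of each
vertex `v` is the cycle `link v 0, link v 1, …` with indices modulo `n`, and the oriented
triangles `(v, link v k, link v (k + 1))` are invariant under cyclic rotation of their vertices
(`rotate`). -/
structure RotationSystem {V : Type*} [DecidableEq V] (n : ℕ) (K : AbstractSimplicialComplex V) where
  link : V → ZMod n → V
  link_injective : ∀ v, Function.Injective (link v)
  link_ne : ∀ v k, link v k ≠ v
  triangle_mem : ∀ v k, {v, link v k, link v (k + 1)} ∈ K.faces
  exists_triangle : ∀ s ∈ K.faces, ∀ v ∈ s, ∃ k, s ⊆ {v, link v k, link v (k + 1)}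
  rotate : ∀ v k, ∃ j, link (link v k) j = link v (k + 1) ∧ link (link v k) (j + 1) = v

namespace RotationSystem

open ZMod

theorem one_ne_zero_of_four_le {n : ℕ} (hn : 4 ≤ n) : (1 : ZMod n) ≠ 0 := by
  have : Fact (1 < n) := ⟨by omega⟩
  exact one_ne_zero

section Star

variable {V : Type*} [Fintype V] {K : AbstractSimplicialComplex V}

/-- The open star of the vertex `v` in the carrier. -/
def star (K : AbstractSimplicialComplex V) (v : V) : Set (Carrier K) := {f | 0 < f.1 v}

theorem continuous_coord (K : AbstractSimplicialComplex V) (v : V) :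
    Continuous fun f : Carrier K => f.1 v :=
  (continuous_apply v).comp continuous_subtype_val

theorem isOpen_star (v : V) : IsOpen (star K v) :=
  isOpen_lt continuous_const (continuous_coord K v)

theorem exists_mem_star (f : Carrier K) : ∃ v, f ∈ star K v := by
  by_contra! h
  have h0 : ∀ v, f.1 v = 0 := fun v => le_antisymm (not_lt.1 (h v)) (f.2.1 v).1
  have := f.2.2.1
  simp [h0] at this

end Star

variable {V : Type*} [DecidableEq V] {n : ℕ} {K : AbstractSimplicialComplex V}
  (R : RotationSystem n K)

/-- A point of the open star of `v` lies in one of the triangles at `v`. -/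
theorem exists_eq_zero [Fintype V] {v : V} {f : Carrier K} (hf : f ∈ star K v) : ∃ k, ∀ w, w ≠ v →
    w ≠ R.link v k → w ≠ R.link v (k + 1) → f.1 w = 0 := by
  obtain ⟨s, hs, hsf⟩ := f.2.2.2
  have hmem (w : V) : w ∈ s ↔ f.1 w ≠ 0 := by
    rw [← Finset.mem_coe, hsf, Function.mem_support]
  obtain ⟨k, hk⟩ := R.exists_triangle s hs v ((hmem v).2 (ne_of_gt hf))
  refine ⟨k, fun w h1 h2 h3 => ?_⟩
  by_contra h
  have := hk ((hmem w).2 h)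
  simp [h1, h2, h3] at this

variable [NeZero n]

/-- The barycentric coordinates of the point of the star of `v` that the chart at `v` sends to
`z`, as a function on the vertices. They lie in the carrier for `z ∈ starTarget n` only. -/
noncomputable def coords (v : V) (z : ℂ) (w : V) : ℝ :=
  (if w = v then 1 - ∑ j : ZMod n, hat j z else 0) +
    ∑ j : ZMod n, if R.link v j = w then hat j z else 0

theorem continuous_coords (v w : V) : Continuous fun z => R.coords v z w := by
  unfold coords
  refine Continuous.add ?_ (continuous_finsetSum _ fun j _ => ?_)
  · split_ifs
    · exact continuous_const.sub (continuous_finsetSum _ fun j _ => continuous_hat j)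
    · exact continuous_const
  · split_ifs
    · exact continuous_hat j
    · exact continuous_const

theorem coords_self (v : V) (z : ℂ) : R.coords v z v = 1 - ∑ j : ZMod n, hat j z := by
  simp [coords, R.link_ne]

theorem coords_link (v : V) (z : ℂ) (k : ZMod n) : R.coords v z (R.link v k) = hat k z := by
  simp [coords, R.link_ne, (R.link_injective v).eq_iff]

theorem coords_of_ne (v : V) (z : ℂ) {w : V} (hv : w ≠ v) (h : ∀ k, w ≠ R.link v k) :
    R.coords v z w = 0 := by
  simp [coords, hv, fun k => (h k).symm]

/-- The open regular polygon with corners `χ k`. -/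
def starTarget (n : ℕ) [NeZero n] : Set ℂ := {z | ∑ j : ZMod n, hat j z < 1}

theorem isOpen_starTarget : IsOpen (starTarget n) :=
  isOpen_lt (continuous_finsetSum _ fun j _ => continuous_hat j) continuous_const

theorem coords_nonneg (hn : 4 ≤ n) (v : V) {z : ℂ} (hz : z ∈ starTarget n) (w : V) :
    0 ≤ R.coords v z w := by
  unfold coords
  refine add_nonneg ?_ (Finset.sum_nonneg fun j _ => ?_)
  · split_ifs
    · exact sub_nonneg.2 (le_of_lt hz)
    · exact le_rfl
  · split_ifs
    · exact hat_nonneg (by omega) j z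
    · exact le_rfl

variable [Fintype V]

/-- The chart at `v`: the map, linear on every triangle at `v`, that sends `v` to `0` and
`link v k` to `χ k`. -/
noncomputable def starMap (v : V) (f : Carrier K) : ℂ := ∑ k, f.1 (R.link v k) * stdAddChar k

theorem continuous_starMap (v : V) : Continuous (R.starMap v) := by
  unfold starMap
  refine continuous_finsetSum _ fun k _ => ?_
  exact (Complex.continuous_ofReal.comp (continuous_coord K _)).mul continuous_const

/-- Sums over the link of `v` of a point in the triangle `v, link v k, link v (k + 1)` reduce to
two terms. -/
theorem sum_link_mul (hn : 4 ≤ n) {v : V} {f : Carrier K} {k : ZMod n} (hk : ∀ w, w ≠ v →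
    w ≠ R.link v k → w ≠ R.link v (k + 1) → f.1 w = 0) (c : ZMod n → ℂ) :
    ∑ j, f.1 (R.link v j) * c j =
      f.1 (R.link v k) * c k + f.1 (R.link v (k + 1)) * c (k + 1) := by
  have h1 := one_ne_zero_of_four_le hn
  rw [← Finset.sum_pair (f := fun k => (f.1 (R.link v k) : ℂ) * c k)
    (show k ≠ k + 1 by simpa using h1)]
  symm
  refine Finset.sum_subset (Finset.subset_univ _) fun j _ hj => ?_
  simp only [Finset.mem_insert, Finset.mem_singleton, not_or] at hj
  rw [hk _ (R.link_ne v j) ((R.link_injective v).ne hj.1) ((R.link_injective v).ne hj.2)]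
  simp

theorem starMap_eq (hn : 4 ≤ n) {v : V} {f : Carrier K} {k : ZMod n} (hk : ∀ w, w ≠ v →
    w ≠ R.link v k → w ≠ R.link v (k + 1) → f.1 w = 0) :
    R.starMap v f = f.1 (R.link v k) * stdAddChar k +
      f.1 (R.link v (k + 1)) * stdAddChar (k + 1) :=
  R.sum_link_mul hn hk _

theorem sum_link {v : V} {f : Carrier K} (hf : f ∈ star K v) :
    ∑ j, f.1 (R.link v j) = 1 - f.1 v := by
  obtain ⟨k, hk⟩ := R.exists_eq_zero hf
  have h : ∑ j, f.1 (R.link v j) = ∑ w ∈ Finset.univ.erase v, f.1 w := by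
    rw [← Finset.sum_image (s := Finset.univ) (g := R.link v) (f := f.1)
      (fun i _ j _ h => R.link_injective v h)]
    refine Finset.sum_subset (fun w hw => ?_) fun w hw hw' => ?_
    · obtain ⟨j, _, rfl⟩ := Finset.mem_image.1 hw
      simp [R.link_ne]
    · refine hk w (by simpa using hw) ?_ ?_ <;>
      · rintro rfl
        exact hw' (Finset.mem_image_of_mem _ (Finset.mem_univ _))
  rw [h, eq_sub_iff_add_eq', Finset.add_sum_erase _ _ (Finset.mem_univ v), f.2.2.1]

theorem hat_starMap (hn : 4 ≤ n) {v : V} {f : Carrier K} (hf : f ∈ star K v) (j : ZMod n) :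
    hat j (R.starMap v f) = f.1 (R.link v j) := by
  obtain ⟨k, hk⟩ := R.exists_eq_zero hf
  rw [R.starMap_eq hn hk, hat_cone hn _ _ (f.2.1 _).1 (f.2.1 _).1]
  split_ifs with h1 h2
  · rw [h1]
  · rw [h2]
  · exact (hk _ (R.link_ne v j) ((R.link_injective v).ne h1) ((R.link_injective v).ne h2)).symm

theorem sum_coords (v : V) (z : ℂ) : ∑ w, R.coords v z w = 1 := by
  unfold coords
  rw [Finset.sum_add_distrib, Finset.sum_comm]
  simp

theorem support_coords_mem (hn : 4 ≤ n) (v : V) {z : ℂ} (hz : z ∈ starTarget n) :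
    ∃ s ∈ K.faces, (s : Set V) = Function.support (R.coords v z) := by
  obtain ⟨k, a, b, ha, hb, hzk⟩ := exists_mem_cone (n := n) (by omega) z
  refine ⟨Finset.univ.filter fun w => R.coords v z w ≠ 0, ?_, by ext w; simp⟩
  have hne : (Finset.univ.filter fun w => R.coords v z w ≠ 0).Nonempty := by
    refine ⟨v, by
      simp only [Finset.mem_filter, Finset.mem_univ, true_and, R.coords_self]
      exact (sub_pos.2 hz).ne'⟩
  refine (K.isRelLowerSet_faces (R.triangle_mem v k)).2 ?_ hne
  intro w hw
  simp only [Finset.mem_filter, Finset.mem_univ, true_and] at hw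
  by_contra h
  simp only [Finset.mem_insert, Finset.mem_singleton, not_or] at h
  by_cases hl : ∃ j, w = R.link v j
  · obtain ⟨j, rfl⟩ := hl
    apply hw
    rw [R.coords_link, hzk, hat_cone hn _ _ ha hb, if_neg (fun e => h.2.1 (by rw [e])),
      if_neg (fun e => h.2.2 (by rw [e]))]
  · push Not at hl
    exact hw (R.coords_of_ne v z h.1 hl)

/-- The inverse of the chart at `v`. -/
noncomputable def ofCoords (hn : 4 ≤ n) (v : V) (z : starTarget n) : Carrier K :=
  ⟨R.coords v z, fun w => ⟨R.coords_nonneg hn v z.2 w, by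
    rw [← R.sum_coords v z]
    exact Finset.single_le_sum (f := R.coords v z) (fun w _ => R.coords_nonneg hn v z.2 w)
      (Finset.mem_univ w)⟩,
    R.sum_coords v z, R.support_coords_mem hn v z.2⟩

theorem ofCoords_mem_star (hn : 4 ≤ n) (v : V) (z : starTarget n) :
    R.ofCoords hn v z ∈ star K v := by
  change 0 < R.coords v z v
  rw [R.coords_self]
  exact sub_pos.2 z.2

theorem starMap_ofCoords (hn : 4 ≤ n) (v : V) (z : starTarget n) :
    R.starMap v (R.ofCoords hn v z) = z := by
  obtain ⟨k, a, b, ha, hb, hzk⟩ := exists_mem_cone (n := n) (by omega) z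
  have h1 := one_ne_zero_of_four_le hn
  have hc : ∀ j, (R.ofCoords hn v z).1 (R.link v j) = hat j (z : ℂ) := R.coords_link v z
  rw [R.starMap_eq hn (k := k), hc, hc, hzk, hat_cone hn _ _ ha hb, hat_cone hn _ _ ha hb]
  · simp [h1]
  · intro w hv h2 h3
    by_cases hl : ∃ j, w = R.link v j
    · obtain ⟨j, rfl⟩ := hl
      rw [hc, hzk, hat_cone hn _ _ ha hb, if_neg (fun e => h2 (by rw [e])),
        if_neg (fun e => h3 (by rw [e]))]
    · push Not at hl
      exact R.coords_of_ne v z hv hl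

theorem sum_hat_starMap (hn : 4 ≤ n) {v : V} {f : Carrier K} (hf : f ∈ star K v) :
    ∑ j : ZMod n, hat j (R.starMap v f) = 1 - f.1 v := by
  simp_rw [R.hat_starMap hn hf]
  exact R.sum_link hf

theorem starMap_mem (hn : 4 ≤ n) {v : V} {f : Carrier K} (hf : f ∈ star K v) :
    R.starMap v f ∈ starTarget n := by
  change ∑ j : ZMod n, hat j (R.starMap v f) < 1
  rw [R.sum_hat_starMap hn hf]
  have : 0 < f.1 v := hf
  linarith

theorem coords_starMap (hn : 4 ≤ n) {v : V} {f : Carrier K} (hf : f ∈ star K v) :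
    R.coords v (R.starMap v f) = f.1 := by
  obtain ⟨k, hk⟩ := R.exists_eq_zero hf
  funext w
  by_cases hv : w = v
  · subst hv
    rw [R.coords_self, R.sum_hat_starMap hn hf, sub_sub_cancel]
  by_cases hl : ∃ j, w = R.link v j
  · obtain ⟨j, rfl⟩ := hl
    rw [R.coords_link, R.hat_starMap hn hf]
  · push Not at hl
    rw [R.coords_of_ne v _ hv hl, hk w hv (hl _) (hl _)]

open Classical in
/-- `starMap` as a chart of the carrier. Outside the target the inverse takes the value `v`, the
point with image `0`. -/
noncomputable def chart (hn : 4 ≤ n) (v : V) : OpenPartialHomeomorph (Carrier K) ℂ where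
  toFun := R.starMap v
  invFun z := if hz : z ∈ starTarget n then R.ofCoords hn v ⟨z, hz⟩ else
    R.ofCoords hn v ⟨0, by
      change ∑ j : ZMod n, hat j 0 < 1
      have h0 (j : ZMod n) : hat j 0 = 0 := by simp [hat]
      simp [h0]⟩
  source := star K v
  target := starTarget n
  map_source' f hf := R.starMap_mem hn hf
  map_target' z hz := by
    rw [dif_pos hz]; exact R.ofCoords_mem_star hn v _
  left_inv' f hf := by
    rw [dif_pos (R.starMap_mem hn hf)]
    exact Subtype.ext (R.coords_starMap hn hf)
  right_inv' z hz := by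
    rw [dif_pos hz, R.starMap_ofCoords]
  open_source := isOpen_star v
  open_target := isOpen_starTarget
  continuousOn_toFun := (R.continuous_starMap v).continuousOn
  continuousOn_invFun := by
    rw [continuousOn_iff_continuous_domRestrict]
    refine Continuous.congr (f := R.ofCoords hn v) ?_ fun z => ?_
    · exact Continuous.subtype_mk (continuous_pi fun w =>
        (R.continuous_coords v w).comp continuous_subtype_val) _
    · simp

end RotationSystem
end DoubleTorus

/-! ### Closed surfaces and orientations from rotation systems -/

namespace DoubleTorus
open Set Filter Topology

section Topology

variable {V : Type*} [Fintype V] (K : AbstractSimplicialComplex V)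

theorem compactSpace_carrier : CompactSpace (Carrier K) := by
  suffices h : IsCompact {f : V → ℝ | (∀ v, f v ∈ Set.Icc (0 : ℝ) 1) ∧
    ∑ v, f v = 1 ∧ ∃ s ∈ K.faces, (s : Set V) = Function.support f} from
    isCompact_iff_compactSpace.1 h
  have hcube : IsCompact (Set.univ.pi fun _ : V => Set.Icc (0 : ℝ) 1) :=
    isCompact_univ_pi fun _ => isCompact_Icc
  have hclosed : IsClosed ({f : V → ℝ | ∑ v, f v = 1} ∩
      ⋃ s ∈ K.faces, {f : V → ℝ | ∀ w, w ∉ s → f w = 0}) := by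
    refine IsClosed.inter (isClosed_eq (by fun_prop) continuous_const) ?_
    refine (Set.toFinite K.faces).isClosed_biUnion fun s _ => ?_
    simp only [Set.ofPred_forall]
    exact isClosed_iInter fun w => isClosed_iInter fun _ =>
      isClosed_eq (continuous_apply w) continuous_const
  convert hcube.inter_right hclosed using 1
  ext f
  simp only [Set.mem_ofPred_eq, Set.mem_inter_iff, Set.mem_univ_pi, Set.mem_iUnion, exists_prop]
  refine and_congr_right fun _ => and_congr_right fun hsum => ⟨?_, ?_⟩
  · rintro ⟨s, hs, hsf⟩
    refine ⟨s, hs, fun w hw => ?_⟩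
    by_contra h
    exact hw (Finset.mem_coe.1 (hsf ▸ Function.mem_support.2 h))
  · rintro ⟨s, hs, hsf⟩
    have hfin : (Function.support f).Finite := Set.toFinite _
    refine ⟨hfin.toFinset, (K.isRelLowerSet_faces hs).2 (fun w hw => ?_) ?_, by simp⟩
    · by_contra h
      exact (by simpa using hw : f w ≠ 0) (hsf w h)
    · by_contra h
      rw [Finset.not_nonempty_iff_eq_empty] at h
      have h0 (w : V) : f w = 0 := by
        by_contra hw
        have : w ∈ hfin.toFinset := by simpa using hw
        simp [h] at this
      simp [h0] at hsum

theorem t2Space_carrier : T2Space (Carrier K) :=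
  inferInstanceAs (T2Space {f : V → ℝ // (∀ v, f v ∈ Set.Icc (0 : ℝ) 1) ∧ ∑ v, f v = 1 ∧
    ∃ s ∈ K.faces, (s : Set V) = Function.support f})

variable [DecidableEq V]

/-- The vertex `v` as a point of the carrier. -/
def vertex (v : V) : Carrier K :=
  ⟨Pi.single v 1, fun w => by by_cases h : w = v <;> simp [h], by simp,
    {v}, K.singleton_mem v, by simp [Pi.support_single_of_ne]⟩

theorem realize_injective : Function.Injective (realize K) := by
  intro π ρ h
  apply Subtype.ext
  ext v
  have h1 := congrArg (fun F => (F (vertex K v)).1 ((π : Equiv.Perm V) v)) h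
  change (Pi.single v 1 : V → ℝ) ((π : Equiv.Perm V).symm ((π : Equiv.Perm V) v)) =
    (Pi.single v 1 : V → ℝ) ((ρ : Equiv.Perm V).symm ((π : Equiv.Perm V) v)) at h1
  rw [Equiv.symm_apply_apply, Pi.single_eq_same, Pi.single_apply] at h1
  split_ifs at h1 with h2
  · exact (Equiv.symm_apply_eq _).1 h2
  · exact absurd h1 one_ne_zero

/-- The open star of `v` is star-shaped about `v`. -/
theorem isPreconnected_star (v : V) : IsPreconnected (RotationSystem.star K v) := by
  have hind : IsInducing (fun f : Carrier K => f.1) := IsInducing.subtypeVal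
  rw [← hind.isPreconnected_image]
  have hv : vertex K v ∈ RotationSystem.star K v := by
    change 0 < (Pi.single v 1 : V → ℝ) v
    simp
  suffices h : StarConvex ℝ (Pi.single v (1 : ℝ))
      ((fun f : Carrier K => f.1) '' RotationSystem.star K v) from
    (h.isPathConnected ⟨vertex K v, hv, rfl⟩).isConnected.isPreconnected
  rintro _ ⟨f, hf, rfl⟩ a b ha hb hab
  have hfv : 0 < f.1 v := hf
  obtain ⟨h01, hsum, s, hs, hsf⟩ := f.2
  set g : V → ℝ := a • Pi.single v 1 + b • f.1 with hg
  have hgw (w : V) : g w = a * (Pi.single v 1 : V → ℝ) w + b * f.1 w := rfl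
  have hnn (w : V) : 0 ≤ g w := by
    rw [hgw]
    have : 0 ≤ (Pi.single v 1 : V → ℝ) w := by
      rw [Pi.single_apply]; split_ifs <;> norm_num
    exact add_nonneg (mul_nonneg ha this) (mul_nonneg hb (h01 w).1)
  have hgsum : ∑ w, g w = 1 := by
    simp_rw [hgw, Finset.sum_add_distrib, ← Finset.mul_sum, hsum]
    simpa using hab
  have hgv : 0 < g v := by
    rw [hgw, Pi.single_eq_same]
    rcases ha.eq_or_lt with rfl | ha
    · have : b = 1 := by linarith
      simpa [this] using hfv
    · have := mul_nonneg hb hfv.le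
      linarith
  refine ⟨⟨g, fun w => ⟨hnn w, ?_⟩, hgsum, s.filter fun w => g w ≠ 0, ?_, ?_⟩, hgv, rfl⟩
  · rw [← hgsum]
    exact Finset.single_le_sum (fun w _ => hnn w) (Finset.mem_univ w)
  · refine (K.isRelLowerSet_faces hs).2 (Finset.filter_subset _ _) ⟨v, ?_⟩
    rw [Finset.mem_filter, ← Finset.mem_coe, hsf]
    exact ⟨hfv.ne', hgv.ne'⟩
  · ext w
    simp only [Finset.coe_filter, Set.mem_ofPred_eq, Function.mem_support, and_iff_right_iff_imp]
    intro hw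
    rw [← Finset.mem_coe, hsf]
    intro h0
    apply hw
    have : w ≠ v := by rintro rfl; exact hfv.ne' h0
    simp [hgw, h0, this]

end Topology

/-- A quotient that is a real number `q ≤ 0` would give `im w₂ = q * im w₂`, hence `im w₂ = 0`. -/
theorem div_mem_slitPlane_of_im_eq {w₁ w₂ : ℂ} (him : w₁.im = w₂.im) (h0 : w₂ ≠ 0)
    (h : w₂.im = 0 → w₁ = w₂) : w₁ / w₂ ∈ Complex.slitPlane := by
  rw [Complex.mem_slitPlane_iff]
  by_contra! hneg
  set q := w₁ / w₂ with hq
  have h1 : w₁ = q * w₂ := (div_mul_cancel₀ _ h0).symm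
  have h2 : w₁.im = q.re * w₂.im := by rw [h1, Complex.mul_im, hneg.2]; ring
  by_cases h3 : w₂.im = 0
  · rw [h h3, div_self h0] at hq
    rw [hq, Complex.one_re] at hneg
    linarith [hneg.1]
  · rw [him] at h2
    have : q.re = 1 := by
      field_simp at h2
      exact h2.symm
    linarith [hneg.1]

namespace RotationSystem

open ZMod

variable {V : Type*} [DecidableEq V] {n : ℕ} {K : AbstractSimplicialComplex V}
  (R : RotationSystem n K)

/-- Seen from the other end of the edge from `v` to `link v k`, the two neighbouring vertices
appear in the opposite order. -/
theorem exists_opposite_link (v : V) (k : ZMod n) : ∃ j, R.link (R.link v k) j = v ∧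
    R.link (R.link v k) (j + 1) = R.link v (k - 1) ∧
    R.link (R.link v k) (j - 1) = R.link v (k + 1) := by
  obtain ⟨j, hj, hj'⟩ := R.rotate v k
  obtain ⟨i, hi, hi'⟩ := R.rotate v (k - 1)
  obtain ⟨l, hl, hl'⟩ := R.rotate (R.link v (k - 1)) i
  rw [sub_add_cancel] at hi
  rw [hi] at hl hl'
  rw [hi'] at hl
  have hlj : l = j + 1 := R.link_injective _ (hl.trans hj'.symm)
  subst hlj
  exact ⟨j + 1, hj', hl', by rw [add_sub_cancel_right, hj]⟩

/-- `π` maps the link of `v` to the link of `π v`, up to a shift of the indices; so it preserves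
the orientation of the triangles. -/
def Preserves (π : Equiv.Perm V) : Prop :=
  ∀ v, ∃ m, ∀ k, π (R.link v k) = R.link (π v) (k + m)

theorem preserves_one : R.Preserves 1 := fun _ => ⟨0, fun k => by simp⟩

theorem Preserves.mul {π ρ : Equiv.Perm V} (hπ : R.Preserves π) (hρ : R.Preserves ρ) :
    R.Preserves (π * ρ) := by
  intro v
  obtain ⟨l, hl⟩ := hρ v
  obtain ⟨m, hm⟩ := hπ (ρ v)
  refine ⟨l + m, fun k => ?_⟩
  rw [Equiv.Perm.mul_apply, hl, hm, add_assoc, Equiv.Perm.mul_apply]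

theorem Preserves.pow {π : Equiv.Perm V} (hπ : R.Preserves π) (k : ℕ) : R.Preserves (π ^ k) := by
  induction k with
  | zero => exact R.preserves_one
  | succ k ih => rw [pow_succ]; exact ih.mul R hπ

theorem Preserves.map_mem {π : Equiv.Perm V} (hπ : R.Preserves π) {s : Finset V}
    (hs : s ∈ K.faces) : s.map π.toEmbedding ∈ K.faces := by
  have hne : s.Nonempty := (K.isRelLowerSet_faces hs).1
  obtain ⟨v, hv⟩ := hne
  obtain ⟨k, hk⟩ := R.exists_triangle s hs v hv
  obtain ⟨m, hm⟩ := hπ v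
  refine (K.isRelLowerSet_faces (R.triangle_mem (π v) (k + m))).2 ?_ ⟨π v, by simpa using hv⟩
  intro w hw
  obtain ⟨x, hx, rfl⟩ := Finset.mem_map.1 hw
  have := hk hx
  simp only [Finset.mem_insert, Finset.mem_singleton] at this
  rcases this with rfl | rfl | rfl
  · simp
  · simp [hm]
  · simp [hm, add_right_comm]

variable [Fintype V] [NeZero n]

/-- The midpoint of an edge lies in the open stars of both ends. -/
theorem exists_mem_star_inter (hn : 4 ≤ n) (v : V) (k : ZMod n) :
    (star K v ∩ star K (R.link v k)).Nonempty := by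
  have h1 := one_ne_zero_of_four_le hn
  have hh (j : ZMod n) := hat_cone hn j k (a := 1 / 2) (b := 0) (by norm_num) le_rfl
  simp only [Complex.ofReal_zero, zero_mul, add_zero, ite_self] at hh
  set z : ℂ := ((1 / 2 : ℝ) : ℂ) * stdAddChar k
  have hz : z ∈ starTarget n := by
    change ∑ j : ZMod n, hat j z < 1
    simp only [hh, Finset.sum_ite_eq', Finset.mem_univ, if_true]
    norm_num
  refine ⟨R.ofCoords hn v ⟨z, hz⟩, R.ofCoords_mem_star hn v _, ?_⟩
  change 0 < R.coords v z (R.link v k)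
  rw [R.coords_link, hh, if_pos rfl]
  norm_num

/-- By `hconn`, any two vertices are joined by a path of exactly two edges. -/
theorem connectedSpace_carrier (hn : 4 ≤ n) [Nonempty V]
    (hconn : ∀ u v, ∃ i j, R.link (R.link u i) j = v) : ConnectedSpace (Carrier K) := by
  have hU : ⋃ v, star K v = Set.univ :=
    Set.eq_univ_of_forall fun f => Set.mem_iUnion.2 (exists_mem_star f)
  have hpre : IsPreconnected (⋃ v, star K v) := by
    refine IsPreconnected.iUnion_of_reflTransGen (isPreconnected_star K) fun u v => ?_
    obtain ⟨i, j, rfl⟩ := hconn u v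
    exact .tail (.single (R.exists_mem_star_inter hn u i)) (R.exists_mem_star_inter hn _ j)
  rw [hU] at hpre
  exact { isPreconnected_univ := hpre, toNonempty := ⟨vertex K (Classical.arbitrary V)⟩ }

theorem isClosedSurface (hn : 4 ≤ n) [Nonempty V]
    (hconn : ∀ u v, ∃ i j, R.link (R.link u i) j = v) : IsClosedSurface (Carrier K) where
  compact := compactSpace_carrier K
  hausdorff := t2Space_carrier K
  connected := R.connectedSpace_carrier hn hconn
  locallyPlanar f := by
    obtain ⟨v, hv⟩ := exists_mem_star f
    exact ⟨R.chart hn v, hv⟩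

/-- The chart at `v` on the star of an edge at `v`. A point there has at most one nonzero
coordinate besides those at the ends of the edge, as it lies in one of the two triangles at the
edge. -/
theorem starMap_edge (hn : 4 ≤ n) {v : V} {k : ZMod n} {f : Carrier K} (hf : f ∈ star K v)
    (hfk : f ∈ star K (R.link v k)) :
    R.starMap v f = stdAddChar k * (f.1 (R.link v k) +
        f.1 (R.link v (k + 1)) * stdAddChar (1 : ZMod n) +
        f.1 (R.link v (k - 1)) * stdAddChar (-1 : ZMod n)) ∧
      f.1 v + f.1 (R.link v k) + f.1 (R.link v (k + 1)) + f.1 (R.link v (k - 1)) = 1 ∧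
      f.1 (R.link v (k + 1)) * f.1 (R.link v (k - 1)) = 0 := by
  have h1 := one_ne_zero_of_four_le hn
  have h2 : (2 : ZMod n) ≠ 0 := by
    intro h
    have h' : ((2 : ℕ) : ZMod n) = 0 := by simpa using h
    rw [ZMod.natCast_eq_zero_iff] at h'
    exact absurd (Nat.le_of_dvd (by norm_num) h') (by omega)
  obtain ⟨i, hi⟩ := R.exists_eq_zero hf
  have hi' (j : ZMod n) (ha : j ≠ i) (hb : j ≠ i + 1) : f.1 (R.link v j) = 0 :=
    hi _ (R.link_ne v j) ((R.link_injective v).ne ha) ((R.link_injective v).ne hb)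
  have hsum : f.1 (R.link v i) + f.1 (R.link v (i + 1)) = 1 - f.1 v := by
    rw [← R.sum_link hf]
    have := R.sum_link_mul hn hi 1
    simp only [Pi.one_apply, mul_one] at this
    exact_mod_cast this.symm
  have hki : k = i ∨ k = i + 1 := by
    by_contra! h
    exact (ne_of_gt hfk : f.1 (R.link v k) ≠ 0) (hi' k h.1 h.2)
  rw [R.starMap_eq hn hi]
  rcases hki with rfl | rfl
  · have h0 : f.1 (R.link v (k - 1)) = 0 := by
      refine hi' _ (by simpa using h1) fun h => h2 ?_
      linear_combination -h
    rw [h0, AddChar.map_add_eq_mul]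
    refine ⟨by push_cast; ring, by linarith, by simp⟩
  · have h0 : f.1 (R.link v (i + 1 + 1)) = 0 := by
      refine hi' _ (fun h => h2 ?_) (by simpa using h1)
      linear_combination h
    have hχ : (stdAddChar (1 : ZMod n) : ℂ) * stdAddChar (-1 : ZMod n) = 1 := by
      rw [← AddChar.map_add_eq_mul]; simp
    rw [h0, AddChar.map_add_eq_mul, add_sub_cancel_right]
    refine ⟨?_, by linarith, by simp⟩
    push_cast
    linear_combination -(f.1 (R.link v i) : ℂ) * stdAddChar i * hχ

theorem injOn_starMap (hn : 4 ≤ n) (v : V) : Set.InjOn (R.starMap v) (star K v) :=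
  (R.chart hn v).injOn

theorem exists_link_eq {u v : V} (huv : u ≠ v) {f : Carrier K} (hv : f ∈ star K v)
    (hu : f ∈ star K u) : ∃ k, R.link v k = u := by
  obtain ⟨i, hi⟩ := R.exists_eq_zero hv
  by_contra! h
  exact (ne_of_gt hu : f.1 u ≠ 0) (hi u huv (h _).symm (h _).symm)

/-- The charts at the ends of an edge define the same orientation, in the form of the criterion
`preservesOrientationAt_of_slitPlane`. The constant `c` maps the direction of the edge in the
chart at `v` to its direction in the chart at `u`. -/
theorem exists_slitPlane (hn : 4 ≤ n) {u v : V} (huv : u ≠ v) {x : Carrier K} (hv : x ∈ star K v)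
    (hu : x ∈ star K u) : ∃ c : ℂ, c ≠ 0 ∧ ∀ f ∈ star K v ∩ star K u, ∀ g ∈ star K v ∩ star K u,
      f ≠ g → (R.starMap u f - R.starMap u g) / (c * (R.starMap v f - R.starMap v g)) ∈
        Complex.slitPlane := by
  obtain ⟨k, rfl⟩ := R.exists_link_eq huv hv hu
  obtain ⟨j, hj, hjm, hjp⟩ := R.exists_opposite_link v k
  refine ⟨-stdAddChar j / stdAddChar k,
    div_ne_zero (neg_ne_zero.2 (stdAddChar_ne_zero j)) (stdAddChar_ne_zero k), ?_⟩
  rintro f ⟨hfv, hfu⟩ g ⟨hgv, hgu⟩ hfg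
  have hD := sub_ne_zero.2 ((R.injOn_starMap hn v).ne hfv hgv hfg)
  obtain ⟨f1, f2, f3⟩ := R.starMap_edge hn hfv hfu
  obtain ⟨g1, g2, g3⟩ := R.starMap_edge hn hgv hgu
  have f4 := (R.starMap_edge hn hfu (k := j) (by rwa [hj])).1
  have g4 := (R.starMap_edge hn hgu (k := j) (by rwa [hj])).1
  rw [hj, hjm, hjp] at f4 g4
  have fp := (f.2.1 (R.link v (k + 1))).1
  have fm := (f.2.1 (R.link v (k - 1))).1
  have gp := (g.2.1 (R.link v (k + 1))).1
  have gm := (g.2.1 (R.link v (k - 1))).1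
  set P : ℝ := f.1 (R.link v (k + 1)) - g.1 (R.link v (k + 1)) with hP
  set M : ℝ := f.1 (R.link v (k - 1)) - g.1 (R.link v (k - 1)) with hM
  set A : ℝ := f.1 (R.link v k) - g.1 (R.link v k) with hA
  set B : ℝ := f.1 v - g.1 v with hB
  have hs := sin_two_pi_div_pos (n := n) (by omega)
  -- for points of the two triangles, `f₊ - f₋` determines both `f₊` and `f₋`
  have hPM : P = M → P = 0 ∧ M = 0 := by
    intro h
    rcases mul_eq_zero.1 f3 with h1 | h1 <;> rcases mul_eq_zero.1 g3 with h2 | h2 <;>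
      constructor <;> linarith
  have hAB : A + B + P + M = 0 := by linarith
  have hne : (stdAddChar (-1 : ZMod n) : ℂ) = (starRingEnd ℂ) (stdAddChar (1 : ZMod n)) :=
    AddChar.map_neg_eq_conj _ _
  have eu : R.starMap (R.link v k) f - R.starMap (R.link v k) g =
      stdAddChar j * (B + M * stdAddChar (1 : ZMod n) + P * stdAddChar (-1 : ZMod n)) := by
    rw [f4, g4, hB, hM, hP]; push_cast; ring
  have ev : R.starMap v f - R.starMap v g =
      stdAddChar k * (A + P * stdAddChar (1 : ZMod n) + M * stdAddChar (-1 : ZMod n)) := by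
    rw [f1, g1, hA, hM, hP]; push_cast; ring
  have hk0 := stdAddChar_ne_zero k
  have hj0 := stdAddChar_ne_zero j
  rw [ev] at hD ⊢
  have hD' := right_ne_zero_of_mul hD
  have : stdAddChar j * (B + M * stdAddChar (1 : ZMod n) + P * stdAddChar (-1 : ZMod n)) /
      (-stdAddChar j / stdAddChar k * (stdAddChar k *
        (A + P * stdAddChar (1 : ZMod n) + M * stdAddChar (-1 : ZMod n)))) =
      -(B + M * stdAddChar (1 : ZMod n) + P * stdAddChar (-1 : ZMod n)) /
        (A + P * stdAddChar (1 : ZMod n) + M * stdAddChar (-1 : ZMod n)) := by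
    field_simp
  rw [eu, this]
  have im1 : (A + P * stdAddChar (1 : ZMod n) + M * stdAddChar (-1 : ZMod n) : ℂ).im =
      (P - M) * Real.sin (2 * Real.pi / n) := by
    rw [hne]
    simp only [Complex.add_im, Complex.ofReal_im, Complex.im_ofReal_mul, Complex.conj_im,
      stdAddChar_one_im]
    ring
  refine div_mem_slitPlane_of_im_eq ?_ hD' fun h => ?_
  · rw [im1, hne]
    simp only [Complex.neg_im, Complex.add_im, Complex.ofReal_im, Complex.im_ofReal_mul,
      Complex.conj_im, stdAddChar_one_im]
    ring
  · rw [im1] at h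
    obtain ⟨hP0, hM0⟩ := hPM (sub_eq_zero.1 ((mul_eq_zero.1 h).resolve_right hs.ne'))
    have : B = -A := by linarith
    simp [this, hP0, hM0]

/-- An orientation-preserving automorphism is a rotation in the charts. -/
theorem starMap_carrierMap {π : autGroup K} {v : V} {m : ZMod n}
    (hm : ∀ k, (π : Equiv.Perm V) (R.link v k) = R.link ((π : Equiv.Perm V) v) (k + m))
    (f : Carrier K) :
    R.starMap ((π : Equiv.Perm V) v) (carrierMap K π f) = stdAddChar m * R.starMap v f := by
  unfold starMap
  rw [Finset.mul_sum, ← Equiv.sum_comp (Equiv.addRight m)]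
  refine Finset.sum_congr rfl fun k _ => ?_
  have : (carrierMap K π f).1 (R.link ((π : Equiv.Perm V) v) (k + m)) = f.1 (R.link v k) := by
    rw [← hm]
    exact congrArg f.1 (Equiv.symm_apply_apply _ _)
  rw [Equiv.coe_addRight, this, AddChar.map_add_eq_mul]
  ring

/-- With `π = 1` this is the compatibility of the charts. -/
theorem preservesOrientationAt_chart (hn : 4 ≤ n) {π : autGroup K} (hπ : R.Preserves π) {v w : V}
    {x : Carrier K} (hx : x ∈ star K v) (hw : carrierMap K π x ∈ star K w) :
    PreservesOrientationAt
      (fun z => R.chart hn w (carrierMap K π ((R.chart hn v).symm z))) (R.chart hn v x) := by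
  obtain ⟨u, rfl⟩ := (π : Equiv.Perm V).surjective w
  obtain ⟨m, hm⟩ := hπ u
  have hwu (f : Carrier K) : f ∈ star K u ↔ carrierMap K π f ∈ star K ((π : Equiv.Perm V) u) := by
    change 0 < f.1 u ↔ 0 < f.1 ((π : Equiv.Perm V).symm ((π : Equiv.Perm V) u))
    rw [Equiv.symm_apply_apply]
  have hχ := stdAddChar_ne_zero m
  have hcont : Continuous fun f => R.starMap ((π : Equiv.Perm V) u) (carrierMap K π f) :=
    (R.continuous_starMap _).comp (continuous_carrierMap K π)
  suffices h : ∃ c : ℂ, c ≠ 0 ∧ ∀ f ∈ star K v ∩ star K u, ∀ g ∈ star K v ∩ star K u, f ≠ g →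
      (R.starMap u f - R.starMap u g) / (c * (R.starMap v f - R.starMap v g)) ∈
        Complex.slitPlane by
    obtain ⟨c, hc, hslit⟩ := h
    refine preservesOrientationAt_comp_symm (R.chart hn v) (isOpen_star u) hx ((hwu x).2 hw)
      hcont.continuousOn (mul_ne_zero hχ hc) fun f hf g hg hfg => ?_
    rw [R.starMap_carrierMap hm, R.starMap_carrierMap hm, ← mul_sub, mul_assoc,
      mul_div_mul_left _ _ hχ]
    exact hslit f hf g hg hfg
  rcases eq_or_ne u v with rfl | huv
  · refine ⟨1, one_ne_zero, fun f hf g hg hfg => ?_⟩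
    rw [one_mul, div_self (sub_ne_zero.2 ((R.injOn_starMap hn u).ne hf.1 hg.1 hfg))]
    exact Complex.one_mem_slitPlane
  · exact R.exists_slitPlane hn huv hx ((hwu x).2 hw)

/-- The orientation of the carrier given by the charts on the open stars. -/
noncomputable def orientation (hn : 4 ≤ n) : SurfaceOrientation (Carrier K) where
  charts := Set.range (R.chart hn)
  cover f := by
    obtain ⟨v, hv⟩ := exists_mem_star f
    exact ⟨R.chart hn v, ⟨v, rfl⟩, hv⟩
  compatible := by
    rintro _ ⟨v, rfl⟩ _ ⟨w, rfl⟩ x ⟨hx, hw⟩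
    have := R.preservesOrientationAt_chart hn (π := 1) R.preserves_one hx (w := w)
      (by rw [carrierMap_one]; exact hw)
    simpa only [carrierMap_one] using this

/-- A faithful action of a group on the vertices that preserves a rotation system is an effective
orientation-preserving simplicial action. -/
theorem exists_actsSimplicially (hn : 4 ≤ n) [Nonempty V]
    (hconn : ∀ u v, ∃ i j, R.link (R.link u i) j = v) {G : Type*} [Group G]
    (ρ : G →* Equiv.Perm V) (hinj : Function.Injective ρ) (hρ : ∀ g, R.Preserves (ρ g)) :
    ∃ ι : G →* autGroup K, ActsSimplicially K ι ∧ ∀ g, (ι g : Equiv.Perm V) = ρ g := by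
  have hmem (g : G) : ρ g ∈ autGroup K := fun s => by
    refine ⟨fun hs => ?_, (hρ g).map_mem R⟩
    have := (hρ g⁻¹).map_mem R hs
    rw [Finset.map_map] at this
    convert this
    symm
    refine Eq.trans (congrArg (fun e => s.map e) ?_) Finset.map_refl
    ext x
    simp
  have hι : Function.Injective (ρ.codRestrict (autGroup K) hmem) := fun g h hgh =>
    hinj (congrArg Subtype.val hgh)
  refine ⟨ρ.codRestrict (autGroup K) hmem, ⟨R.isClosedSurface hn hconn, hι,
    (realize_injective K).comp hι, R.orientation hn, fun g => ?_⟩, fun g => rfl⟩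
  rintro _ ⟨v, rfl⟩ _ ⟨w, rfl⟩ x hx hw
  exact R.preservesOrientationAt_chart hn (π := ⟨ρ g, hmem g⟩) (hρ g) hx hw

end RotationSystem
end DoubleTorus

/-! ### The five triangulations and their groups -/

namespace DoubleTorus

/-- A rotation system on a complex given by its faces, from conditions that can be decided. -/
def RotationSystem.ofLinks {V : Type*} [DecidableEq V] {n : ℕ} {F : List (V × V × V)}
    {h : ∀ x : V, ∃ t ∈ F, x ∈ ({t.1, t.2.1, t.2.2} : Finset V)} (link : V → ZMod n → V)
    (hinj : ∀ v, Function.Injective (link v)) (hne : ∀ v k, link v k ≠ v)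
    (htri : ∀ v k, ∃ t ∈ F, ({v, link v k, link v (k + 1)} : Finset V) ⊆ {t.1, t.2.1, t.2.2})
    (hF : ∀ t ∈ F, ∀ v ∈ ({t.1, t.2.1, t.2.2} : Finset V), ∃ k,
      ({t.1, t.2.1, t.2.2} : Finset V) ⊆ {v, link v k, link v (k + 1)})
    (hrot : ∀ v k, ∃ j, link (link v k) j = link v (k + 1) ∧ link (link v k) (j + 1) = v) :
    RotationSystem n (ofFaces F h) where
  link := link
  link_injective := hinj
  link_ne := hne
  triangle_mem v k := ⟨Finset.insert_nonempty _ _, htri v k⟩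
  exists_triangle := by
    rintro s ⟨-, t, ht, hst⟩ v hv
    obtain ⟨k, hk⟩ := hF t ht v (hst hv)
    exact ⟨k, hst.trans hk⟩
  rotate := hrot

/-- The link cycles of `N1`, in the cyclic order of one orientation of the triangles. -/
def linkN1 : Fin 12 → ZMod 7 → Fin 12 :=
  ![![1, 2, 6, 8, 4, 10, 11],
    ![0, 11, 5, 9, 7, 3, 2],
    ![0, 1, 3, 4, 8, 10, 6],
    ![1, 7, 11, 9, 5, 4, 2],
    ![0, 8, 2, 3, 5, 6, 10],
    ![1, 11, 7, 6, 4, 3, 9],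
    ![0, 2, 10, 4, 5, 7, 8],
    ![1, 9, 8, 6, 5, 11, 3],
    ![0, 6, 7, 9, 10, 2, 4],
    ![1, 5, 3, 11, 10, 8, 7],
    ![0, 4, 6, 2, 8, 9, 11],
    ![0, 10, 9, 3, 7, 5, 1]]

/-- The rotation system of `N1` given by its link cycles. -/
def rotationN1 : RotationSystem 7 N1 :=
  .ofLinks linkN1 (by decide +kernel) (by decide +kernel) (by decide +kernel)
    (by decide +kernel) (by decide +kernel)

/-- The link cycles of `N2`, in the cyclic order of one orientation of the triangles. -/
def linkN2 : Fin 12 → ZMod 7 → Fin 12 :=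
  ![![1, 5, 11, 4, 8, 7, 6],
    ![0, 6, 2, 7, 8, 9, 5],
    ![1, 6, 10, 9, 8, 3, 7],
    ![2, 8, 4, 9, 10, 11, 7],
    ![0, 11, 10, 5, 9, 3, 8],
    ![0, 1, 9, 4, 10, 6, 11],
    ![0, 7, 11, 5, 10, 2, 1],
    ![0, 8, 1, 2, 3, 11, 6],
    ![0, 4, 3, 2, 9, 1, 7],
    ![1, 8, 2, 10, 3, 4, 5],
    ![2, 6, 5, 4, 11, 3, 9],
    ![0, 5, 6, 7, 3, 10, 4]]

/-- The rotation system of `N2` given by its link cycles. -/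
def rotationN2 : RotationSystem 7 N2 :=
  .ofLinks linkN2 (by decide +kernel) (by decide +kernel) (by decide +kernel)
    (by decide +kernel) (by decide +kernel)

/-- The link cycles of `N3`, in the cyclic order of one orientation of the triangles. -/
def linkN3 : Fin 12 → ZMod 7 → Fin 12 :=
  ![![2, 8, 4, 6, 10, 9, 11],
    ![2, 11, 5, 9, 7, 3, 4],
    ![0, 11, 1, 4, 10, 6, 8],
    ![1, 7, 11, 9, 5, 6, 4],
    ![0, 8, 10, 2, 1, 3, 6],
    ![1, 11, 7, 8, 6, 3, 9],
    ![0, 4, 3, 5, 8, 2, 10],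
    ![1, 9, 10, 8, 5, 11, 3],
    ![0, 2, 6, 5, 7, 10, 4],
    ![0, 10, 7, 1, 5, 3, 11],
    ![0, 6, 2, 4, 8, 7, 9],
    ![0, 9, 3, 7, 5, 1, 2]]

/-- The rotation system of `N3` given by its link cycles. -/
def rotationN3 : RotationSystem 7 N3 :=
  .ofLinks linkN3 (by decide +kernel) (by decide +kernel) (by decide +kernel)
    (by decide +kernel) (by decide +kernel)

/-- The link cycles of `N5`, in the cyclic order of one orientation of the triangles. -/
def linkN5 : Fin 12 → ZMod 7 → Fin 12 :=
  ![![1, 2, 11, 4, 8, 7, 9],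
    ![0, 9, 5, 4, 11, 10, 2],
    ![0, 1, 10, 6, 5, 3, 11],
    ![2, 5, 8, 4, 6, 7, 11],
    ![0, 11, 1, 5, 6, 3, 8],
    ![1, 9, 8, 3, 2, 6, 4],
    ![2, 10, 9, 7, 3, 4, 5],
    ![0, 8, 10, 11, 3, 6, 9],
    ![0, 4, 3, 5, 9, 10, 7],
    ![0, 7, 6, 10, 8, 5, 1],
    ![1, 11, 7, 8, 9, 6, 2],
    ![0, 2, 3, 7, 10, 1, 4]]

/-- The rotation system of `N5` given by its link cycles. -/
def rotationN5 : RotationSystem 7 N5 :=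
  .ofLinks linkN5 (by decide +kernel) (by decide +kernel) (by decide +kernel)
    (by decide +kernel) (by decide +kernel)

/-- The link cycles of `N6`, in the cyclic order of one orientation of the triangles. -/
def linkN6 : Fin 12 → ZMod 7 → Fin 12 :=
  ![![1, 7, 8, 4, 11, 3, 10],
    ![0, 10, 9, 5, 8, 2, 7],
    ![1, 8, 11, 9, 10, 6, 7],
    ![0, 11, 7, 6, 4, 5, 10],
    ![0, 8, 5, 3, 6, 9, 11],
    ![1, 9, 6, 10, 3, 4, 8],
    ![2, 10, 5, 9, 4, 3, 7],
    ![0, 1, 2, 6, 3, 11, 8],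
    ![0, 7, 11, 2, 1, 5, 4],
    ![1, 10, 2, 11, 4, 6, 5],
    ![0, 3, 5, 6, 2, 9, 1],
    ![0, 4, 9, 2, 8, 7, 3]]

/-- The rotation system of `N6` given by its link cycles. -/
def rotationN6 : RotationSystem 7 N6 :=
  .ofLinks linkN6 (by decide +kernel) (by decide +kernel) (by decide +kernel)
    (by decide +kernel) (by decide +kernel)

/-- The action of `ℤ₆` through `σ²`. -/
def rotationHom6 : Multiplicative (ZMod 6) →* Equiv.Perm (Fin 12) :=
  MonoidHom.mk' (fun g => (sigma ^ 2) ^ (Multiplicative.toAdd g).val) (by decide +kernel)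

/-- The function on the dihedral group with `r ↦ ρ` and `s ↦ τ`; it is multiplicative when `ρ` and
`τ` satisfy the relations of the group. Here `sr i` is the product of `s` and the `i`-th power of
`r`. -/
def dihedralFun {n : ℕ} {G : Type*} [Group G] (ρ τ : G) : DihedralGroup n → G
  | .r i => ρ ^ i.val
  | .sr i => τ * ρ ^ i.val

/-- The action of `D₆` through `σ²` and `τ`. -/
def dihedralHom6 : DihedralGroup 6 →* Equiv.Perm (Fin 12) :=
  MonoidHom.mk' (dihedralFun (sigma ^ 2) tau) (by decide +kernel)

/-- The action of `D₃` through `α` and `β`. -/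
def dihedralHom3 : DihedralGroup 3 →* Equiv.Perm (Fin 12) :=
  MonoidHom.mk' (dihedralFun alpha beta) (by decide +kernel)

/-- The action of `ℤ₂ × ℤ₂` through `α₁` and `α₂`. -/
def kleinHom : Multiplicative (ZMod 2 × ZMod 2) →* Equiv.Perm (Fin 12) :=
  MonoidHom.mk' (fun g => alpha1 ^ (Multiplicative.toAdd g).1.val *
    alpha2 ^ (Multiplicative.toAdd g).2.val) (by decide +kernel)

theorem preserves_dihedralFun {V : Type*} [DecidableEq V] {n : ℕ} {K : AbstractSimplicialComplex V}
    (R : RotationSystem n K) {m : ℕ} {ρ τ : Equiv.Perm V} (hρ : R.Preserves ρ)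
    (hτ : R.Preserves τ) (g : DihedralGroup m) : R.Preserves (dihedralFun ρ τ g) := by
  cases g with
  | r i => exact hρ.pow R _
  | sr i => exact hτ.mul R (hρ.pow R _)

theorem rotationN1_preserves : rotationN1.Preserves (sigma ^ 2) := by
  unfold RotationSystem.Preserves; decide +kernel

theorem rotationN2_preserves : rotationN2.Preserves (sigma ^ 2) := by
  unfold RotationSystem.Preserves; decide +kernel

theorem rotationN3_preserves_sigma : rotationN3.Preserves (sigma ^ 2) := by
  unfold RotationSystem.Preserves; decide +kernel

theorem rotationN3_preserves_tau : rotationN3.Preserves tau := by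
  unfold RotationSystem.Preserves; decide +kernel

theorem rotationN5_preserves_alpha : rotationN5.Preserves alpha := by
  unfold RotationSystem.Preserves; decide +kernel

theorem rotationN5_preserves_beta : rotationN5.Preserves beta := by
  unfold RotationSystem.Preserves; decide +kernel

theorem rotationN6_preserves_alpha1 : rotationN6.Preserves alpha1 := by
  unfold RotationSystem.Preserves; decide +kernel

theorem rotationN6_preserves_alpha2 : rotationN6.Preserves alpha2 := by
  unfold RotationSystem.Preserves; decide +kernel

end DoubleTorus

/-- `ℤ₆` acts on `|N1|` and `|N2|` through `1 ↦ σ²`; `D₆` (order 12) acts on `|N3|` through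
`r ↦ σ²`, `s ↦ τ`; `D₃` acts on `|N5|` through `r ↦ α`, `s ↦ β`; `ℤ₂ × ℤ₂` acts on `|N6|` through
`(1,0) ↦ α₁`, `(0,1) ↦ α₂`. -/
theorem lemma2p4 :
    (∃ ι : Multiplicative (ZMod 6) →* DoubleTorus.autGroup DoubleTorus.N1,
      DoubleTorus.ActsSimplicially DoubleTorus.N1 ι ∧
        (ι (Multiplicative.ofAdd 1) : Equiv.Perm (Fin 12)) = DoubleTorus.sigma ^ 2) ∧
    (∃ ι : Multiplicative (ZMod 6) →* DoubleTorus.autGroup DoubleTorus.N2,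
      DoubleTorus.ActsSimplicially DoubleTorus.N2 ι ∧
        (ι (Multiplicative.ofAdd 1) : Equiv.Perm (Fin 12)) = DoubleTorus.sigma ^ 2) ∧
    (∃ ι : DihedralGroup 6 →* DoubleTorus.autGroup DoubleTorus.N3,
      DoubleTorus.ActsSimplicially DoubleTorus.N3 ι ∧
        (ι (DihedralGroup.r 1) : Equiv.Perm (Fin 12)) = DoubleTorus.sigma ^ 2 ∧
        (ι (DihedralGroup.sr 0) : Equiv.Perm (Fin 12)) = DoubleTorus.tau) ∧
    (∃ ι : DihedralGroup 3 →* DoubleTorus.autGroup DoubleTorus.N5,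
      DoubleTorus.ActsSimplicially DoubleTorus.N5 ι ∧
        (ι (DihedralGroup.r 1) : Equiv.Perm (Fin 12)) = DoubleTorus.alpha ∧
        (ι (DihedralGroup.sr 0) : Equiv.Perm (Fin 12)) = DoubleTorus.beta) ∧
    (∃ ι : Multiplicative (ZMod 2 × ZMod 2) →* DoubleTorus.autGroup DoubleTorus.N6,
      DoubleTorus.ActsSimplicially DoubleTorus.N6 ι ∧
        (ι (Multiplicative.ofAdd (1, 0)) : Equiv.Perm (Fin 12)) = DoubleTorus.alpha1 ∧
        (ι (Multiplicative.ofAdd (0, 1)) : Equiv.Perm (Fin 12)) = DoubleTorus.alpha2) := by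
  refine ⟨?_, ?_, ?_, ?_, ?_⟩
  · obtain ⟨ι, h, hι⟩ := DoubleTorus.rotationN1.exists_actsSimplicially (by norm_num)
      (by decide +kernel) DoubleTorus.rotationHom6 (by decide +kernel)
      fun g => DoubleTorus.rotationN1_preserves.pow _ _
    exact ⟨ι, h, (hι _).trans (by decide +kernel)⟩
  · obtain ⟨ι, h, hι⟩ := DoubleTorus.rotationN2.exists_actsSimplicially (by norm_num)
      (by decide +kernel) DoubleTorus.rotationHom6 (by decide +kernel)
      fun g => DoubleTorus.rotationN2_preserves.pow _ _
    exact ⟨ι, h, (hι _).trans (by decide +kernel)⟩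
  · obtain ⟨ι, h, hι⟩ := DoubleTorus.rotationN3.exists_actsSimplicially (by norm_num)
      (by decide +kernel) DoubleTorus.dihedralHom6 (by decide +kernel)
      (DoubleTorus.preserves_dihedralFun _ DoubleTorus.rotationN3_preserves_sigma
        DoubleTorus.rotationN3_preserves_tau)
    exact ⟨ι, h, (hι _).trans (by decide +kernel), (hι _).trans (by decide +kernel)⟩
  · obtain ⟨ι, h, hι⟩ := DoubleTorus.rotationN5.exists_actsSimplicially (by norm_num)
      (by decide +kernel) DoubleTorus.dihedralHom3 (by decide +kernel)
      (DoubleTorus.preserves_dihedralFun _ DoubleTorus.rotationN5_preserves_alpha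
        DoubleTorus.rotationN5_preserves_beta)
    exact ⟨ι, h, (hι _).trans (by decide +kernel), (hι _).trans (by decide +kernel)⟩
  · obtain ⟨ι, h, hι⟩ := DoubleTorus.rotationN6.exists_actsSimplicially (by norm_num)
      (by decide +kernel) DoubleTorus.kleinHom (by decide +kernel)
      fun g => (DoubleTorus.rotationN6_preserves_alpha1.pow _ _).mul _
        (DoubleTorus.rotationN6_preserves_alpha2.pow _ _)
    exact ⟨ι, h, (hι _).trans (by decide +kernel), (hι _).trans (by decide +kernel)⟩
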